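/- Let $I=\,]a,b[\,\subseteq\mathbb{R}$ be an open interval (possibly unbounded), and let $\varphi:I\to\mathbb{R}$ be a smooth, strictly increasing function such that $$\ddot\varphi+\lambda\,\dot\varphi^{2}\ge 0\quad\text{on } I\qquad\text{for some constant }\lambda>0 .$$ Let $\Sigma$ be a connected smooth surface without boundary and let $f:\Sigma\to\mathbb{R}^{2}\times I\subseteq\mathbb{R}^{3}$ be a smooth immersion with smooth unit normal field (Gauss map) $N:\Sigma\to\mathbb{S}^{2}$. Let $H$ be its mean curvature, i.e. the trace, with respect to the first fundamental form $\langle df(u),df(v)\rangle$, of the second fundamental form $\mathcal{S}(u,v)=\langle dN(u),df(v)\rangle$. Assume that $f$ is a $[\varphi,\vec e_3]$-minimal immersion, that is, $$H=-\langle\overline\nabla\varphi,N\rangle=-\dot\varphi\,\langle N,\vec e_3\rangle ,$$ where $\varphi$ is regarded as the function $(x_1,x_2,x_3)\mapsto\varphi(x_3)$ on $\mathbb{R}^2\times I$, $\overline\nabla$ is the gradient of $\mathbb{R}^3$, $\vec e_3=(0,0,1)$, and $\dot\varphi$, $\langle N,\vec e_3\rangle$ are taken at $f(p)$ and $p$ respectively.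 Assume also that $H\le 0$ on $\Sigma$. If $H$ vanishes at some point of $\Sigma$, then $H$ vanishes identically and $f(\Sigma)$ is contained in a vertical plane (an affine plane of $\mathbb{R}^3$ parallel to $\vec e_3$). -/

import Mathlib

open scoped Manifold ContDiff

/-- Euclidean three-space. -/
abbrev E3 : Type := EuclideanSpace ℝ (Fin 3)

/-- The vertical unit vector `(0, 0, 1)`. -/
noncomputable def e3 : E3 := EuclideanSpace.single 2 1

section Surface

variable {M : Type*} [TopologicalSpace M] [ChartedSpace (EuclideanSpace ℝ (Fin 2)) M]

/-- The differential at `p` of an `ℝ³`-valued map on the surface `M`. The tangent plane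
`TangentSpace (𝓡 2) p` is by definition a copy of the model space `ℝ²` (the identification being
given by the preferred chart at `p`), and is written as such here. -/
noncomputable def surfDiff (f : M → E3) (p : M) : EuclideanSpace ℝ (Fin 2) →L[ℝ] E3 :=
  mfderiv (𝓡 2) 𝓘(ℝ, E3) f p

/-- The first fundamental form `⟨df u, df v⟩` of `f` at `p`. -/
noncomputable def firstForm (f : M → E3) (p : M) (u v : EuclideanSpace ℝ (Fin 2)) : ℝ :=
  inner ℝ (surfDiff f p u) (surfDiff f p v)

/-- The second fundamental form `⟨dN u, df v⟩` of `f` at `p` with respect to the Gauss map `N`.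
In this sign convention the mean curvature vector is `-H N`. -/
noncomputable def secondForm (f N : M → E3) (p : M) (u v : EuclideanSpace ℝ (Fin 2)) : ℝ :=
  inner ℝ (surfDiff N p u) (surfDiff f p v)

/-- The basis of the tangent plane given by the coordinate vectors of the preferred chart. -/
noncomputable def coordVec (i : Fin 2) : EuclideanSpace ℝ (Fin 2) :=
  EuclideanSpace.single i 1

/-- The mean curvature (the sum of the two principal curvatures): the trace of the second
fundamental form with respect to the first one. For an immersion this trace does not depend on
the basis in which the two Gram matrices are taken. -/
noncomputable def meanCurvature (f N : M → E3) (p : M) : ℝ :=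
  ((Matrix.of fun i j => firstForm f p (coordVec i) (coordVec j))⁻¹ *
    Matrix.of fun i j => secondForm f N p (coordVec i) (coordVec j)).trace

/-- `f : M → ℝ³` is a smooth immersion of the surface `M`. -/
structure IsSmoothImmersion (f : M → E3) : Prop where
  smooth : ContMDiff (𝓡 2) 𝓘(ℝ, E3) ∞ f
  injective_diff : ∀ p, Function.Injective (surfDiff f p)

/-- `N` is a (globally defined, smooth) Gauss map of `f`: a unit normal field along `f`. -/
structure IsGaussMap (f N : M → E3) : Prop where
  smooth : ContMDiff (𝓡 2) 𝓘(ℝ, E3) ∞ N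
  norm_eq_one : ∀ p, ‖N p‖ = 1
  normal : ∀ p v, inner ℝ (surfDiff f p v) (N p) = 0

/-- The immersion `f` with Gauss map `N` is a `[φ, e₃]`-minimal immersion in `ℝ² × I`:
`H = -⟨∇φ, N⟩`, where `φ` is regarded as the function `x ↦ φ(x₃)` on `ℝ² × I` and `∇` is the
gradient of `ℝ³`. -/
structure IsPhiMinimal (φ : ℝ → ℝ) (I : Set ℝ) (f N : M → E3) : Prop where
  immersion : IsSmoothImmersion f
  gaussMap : IsGaussMap f N
  mem_slab : ∀ p, f p 2 ∈ I
  meanCurvature_eq : ∀ p,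
    meanCurvature f N p = -inner ℝ (gradient (fun x : E3 => φ (x 2)) (f p)) (N p)

end Surface

/-- A vertical plane of `ℝ³`: an affine plane parallel to `e₃`. -/
def IsVerticalPlane (P : AffineSubspace ℝ E3) : Prop :=
  Module.finrank ℝ P.direction = 2 ∧ e3 ∈ P.direction

/-!
The angle function `u = ⟨N, e₃⟩` satisfies the Jacobi equation of the vertical translations, and
substituting `H = -φ' u` into it turns it into a linear elliptic equation `L u + c u = 0`. The
function `exp (λ φ) φ'` is nondecreasing because `φ'' + λ φ'² ≥ 0`, so `φ'` has no zero; hence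
`H ≤ 0` means `u ≥ 0`, and a zero of `H` is a zero of `u`. By the strong minimum principle `u`
vanishes identically, and so does `H`. Then `dN` is self-adjoint and trace-free, and it kills the
tangential direction `e₃`, so in dimension two it vanishes: `N` is a constant horizontal vector.
-/

section MinimumPrinciple

open Filter Topology Metric

theorem deriv_deriv_nonneg_of_isLocalMin {g : ℝ → ℝ} {t : ℝ} (hmin : IsLocalMin g t)
    (hg : ContinuousAt g t) : 0 ≤ deriv (deriv g) t := by
  by_contra! hneg
  have hmax : IsLocalMax g t := isLocalMax_of_deriv_deriv_neg hneg hmin.deriv_eq_zero hg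
  have hconst : g =ᶠ[𝓝 t] fun _ => g t := by
    filter_upwards [hmin, hmax] with s h₁ h₂ using le_antisymm h₂ h₁
  have hderiv : deriv g =ᶠ[𝓝 t] fun _ => 0 := by simpa only [deriv_const'] using hconst.deriv
  exact hneg.ne (by rw [hderiv.deriv_eq, deriv_const])

section SecondOrderCondition

variable {E : Type*} [NormedAddCommGroup E] [NormedSpace ℝ E] {ι : Type*} [Fintype ι]

theorem deriv_deriv_comp_line {u : E → ℝ} {x : E} (hu : ContDiffAt ℝ 2 u x) (v : E) :
    deriv (deriv fun t : ℝ => u (x + t • v)) 0 = fderiv ℝ (fderiv ℝ u) x v v := by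
  have hline (t : ℝ) : HasDerivAt (fun t : ℝ => x + t • v) v t := by
    simpa using ((hasDerivAt_id t).smul_const v).const_add x
  have htendsto : Tendsto (fun t : ℝ => x + t • v) (𝓝 0) (𝓝 x) :=
    Continuous.tendsto' (by fun_prop) _ _ (by simp)
  have hfirst : deriv (fun t : ℝ => u (x + t • v)) =ᶠ[𝓝 0] fun t => fderiv ℝ u (x + t • v) v := by
    filter_upwards [htendsto.eventually (hu.eventually (by simp))] with t ht
    exact ((ht.differentiableAt two_ne_zero).hasFDerivAt.comp_hasDerivAt t (hline t)).deriv
  have hsecond : HasFDerivAt (fderiv ℝ u) (fderiv ℝ (fderiv ℝ u) x) (x + (0 : ℝ) • v) := by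
    rw [zero_smul, add_zero]
    exact ((hu.fderiv_right (m := 1) (by norm_num)).differentiableAt one_ne_zero).hasFDerivAt
  rw [hfirst.deriv_eq]
  exact ((ContinuousLinearMap.apply ℝ ℝ v).hasFDerivAt.comp_hasDerivAt 0
    (hsecond.comp_hasDerivAt 0 (hline 0))).deriv

theorem fderiv_fderiv_nonneg_of_isLocalMin {u : E → ℝ} {x : E} (hu : ContDiffAt ℝ 2 u x)
    (hmin : IsLocalMin u x) (v : E) : 0 ≤ fderiv ℝ (fderiv ℝ u) x v v := by
  have hline : Tendsto (fun t : ℝ => x + t • v) (𝓝 0) (𝓝 x) :=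
    Continuous.tendsto' (by fun_prop) _ _ (by simp)
  rw [← deriv_deriv_comp_line hu v]
  refine deriv_deriv_nonneg_of_isLocalMin ?_ ?_
  · simpa [IsLocalMin, IsMinFilter] using hline.eventually hmin
  · exact ContinuousAt.comp (by simpa using hu.continuousAt) (by fun_prop)

/-- The value at `x` of the linear second-order differential operator `∑ (∂_{V k})² + ∂_b + c`
applied to `u`. The principal part is a sum of squares of directions; it is elliptic where
these span. -/
noncomputable def ellipticOperator (V : ι → E → E) (b : E → E) (c u : E → ℝ) (x : E) : ℝ :=
  ∑ k, fderiv ℝ (fderiv ℝ u) x (V k x) (V k x) + fderiv ℝ u x (b x) + c x * u x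

theorem ellipticOperator_const_smul (V : ι → E → E) (b : E → E) (c u : E → ℝ) (a : ℝ) (x : E) :
    ellipticOperator V b c (a • u) x = a * ellipticOperator V b c u x := by
  have hfirst : fderiv ℝ (a • u) = a • fderiv ℝ u := fderiv_const_smul_field a
  have hsecond : fderiv ℝ (a • fderiv ℝ u) = a • fderiv ℝ (fderiv ℝ u) :=
    fderiv_const_smul_field (f := fderiv ℝ u) a
  simp only [ellipticOperator, hfirst, hsecond, Pi.smul_apply, smul_apply, smul_eq_mul, mul_add,
    Finset.mul_sum, mul_left_comm]

theorem ellipticOperator_le_of_isLocalMin_sub {V : ι → E → E} {b : E → E} {u w : E → ℝ} {x : E}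
    (hu : ContDiffAt ℝ 2 u x) (hw : ContDiffAt ℝ 2 w x) (hmin : IsLocalMin (u - w) x) :
    ellipticOperator V b 0 w x ≤ ellipticOperator V b 0 u x := by
  have hdiff {g : E → ℝ} (hg : ContDiffAt ℝ 2 g x) :
      ∀ᶠ y in 𝓝 x, DifferentiableAt ℝ g y :=
    (hg.eventually (by simp)).mono fun y hy => hy.differentiableAt two_ne_zero
  have hdiff' {g : E → ℝ} (hg : ContDiffAt ℝ 2 g x) : DifferentiableAt ℝ (fderiv ℝ g) x :=
    (hg.fderiv_right (m := 1) (by norm_num)).differentiableAt one_ne_zero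
  have hsub : fderiv ℝ (u - w) =ᶠ[𝓝 x] fderiv ℝ u - fderiv ℝ w := by
    filter_upwards [hdiff hu, hdiff hw] with y huy hwy using fderiv_sub huy hwy
  have hfirst : fderiv ℝ u x = fderiv ℝ w x := by
    rw [← sub_eq_zero, ← Pi.sub_apply, ← hsub.self_of_nhds, hmin.fderiv_eq_zero]
  have hsecond (v : E) : fderiv ℝ (fderiv ℝ w) x v v ≤ fderiv ℝ (fderiv ℝ u) x v v := by
    have h := fderiv_fderiv_nonneg_of_isLocalMin (u := u - w) (hu.sub hw) hmin v
    rwa [hsub.fderiv_eq, fderiv_sub (hdiff' hu) (hdiff' hw), sub_apply, sub_apply, sub_nonneg] at h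
  simp only [ellipticOperator, Pi.zero_apply, zero_mul, hfirst]
  gcongr
  exact hsecond _

theorem ellipticOperator_pos_of_isLocalMin_sub_const_smul {V : ι → E → E} {b : E → E}
    {c u w : E → ℝ} {x : E} {C ε : ℝ} (hu : ContDiffAt ℝ 2 u x) (hw : ContDiffAt ℝ 2 w x)
    (hε : 0 < ε) (hmin : IsLocalMin (u - ε • w) x) (hnonneg : 0 ≤ u x) (hle : u x ≤ ε * w x)
    (hc : |c x| ≤ C) (hstrict : C * w x < ellipticOperator V b 0 w x) :
    0 < ellipticOperator V b c u x := by
  have hcompare := ellipticOperator_le_of_isLocalMin_sub (V := V) (b := b) (w := ε • w) hu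
    (hw.const_smul ε) hmin
  rw [ellipticOperator_const_smul] at hcompare
  have hzeroth : -(C * (ε * w x)) ≤ c x * u x := by
    have hCu : C * u x ≤ C * (ε * w x) := by
      gcongr
      exact (abs_nonneg _).trans hc
    linarith [mul_le_mul_of_nonneg_right (abs_le.1 hc).1 hnonneg]
  have hsplit : ellipticOperator V b c u x = ellipticOperator V b 0 u x + c x * u x := by
    simp [ellipticOperator]
  linarith [mul_lt_mul_of_pos_left hstrict hε]

end SecondOrderCondition

theorem exists_isLocalMin_sub_const_mul {E : Type*} [PseudoMetricSpace E] [ProperSpace E]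
    {u w : E → ℝ} {z : E} {ρ : ℝ} (hρ : 0 < ρ) (hu : ContinuousOn u (closedBall z ρ))
    (hw : ContinuousOn w (closedBall z ρ)) (huz : u z = 0) (hwz : 0 ≤ w z)
    (hnonneg : ∀ x ∈ closedBall z ρ, 0 ≤ u x)
    (hpos : ∀ x ∈ sphere z ρ, w z ≤ w x → 0 < u x) :
    ∃ ε > 0, ∃ x ∈ ball z ρ, u x ≤ ε * w x ∧ IsLocalMin (u - ε • w) x := by
  have hz : z ∈ closedBall z ρ := mem_closedBall_self hρ.le
  have hcpt : IsCompact (closedBall z ρ) := isCompact_closedBall z ρ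
  obtain ⟨B, hB⟩ := hcpt.exists_bound_of_continuousOn hw
  have hB₀ : 0 ≤ B := (norm_nonneg _).trans (hB z hz)
  obtain ⟨δ, hδ, hδu⟩ : ∃ δ > 0, ∀ x ∈ sphere z ρ ∩ {x | w z ≤ w x}, δ ≤ u x := by
    have hws : ContinuousOn w (sphere z ρ) := hw.mono sphere_subset_closedBall
    have hTcpt : IsCompact (sphere z ρ ∩ w ⁻¹' Set.Ici (w z)) :=
      (isCompact_sphere z ρ).of_isClosed_subset
        (hws.preimage_isClosed_of_isClosed isClosed_sphere isClosed_Ici) Set.inter_subset_left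
    exact hTcpt.exists_forall_le'
      (hu.mono (Set.inter_subset_left.trans sphere_subset_closedBall)) fun x hx => hpos x hx.1 hx.2
  set ε := δ / (B + 1)
  have hε : 0 < ε := by positivity
  have hεB : ε * B < δ := by
    rw [div_mul_eq_mul_div, div_lt_iff₀ (by positivity)]
    gcongr
    linarith
  obtain ⟨x, hx, hxmin⟩ := hcpt.exists_isMinOn ⟨z, hz⟩ (hu.sub (hw.const_mul ε))
  have hxz : u x - ε * w x ≤ -(ε * w z) := by simpa [huz] using hxmin hz
  have hsphere : x ∉ sphere z ρ := by
    intro hxs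
    rcases lt_or_ge (w x) (w z) with hlt | hge
    · linarith [hnonneg x hx, mul_lt_mul_of_pos_left hlt hε]
    · have hwB : ε * w x ≤ ε * B := by gcongr; exact (le_abs_self _).trans (hB x hx)
      linarith [hδu x ⟨hxs, hge⟩, mul_nonneg hε.le hwz]
  have hball : x ∈ ball z ρ := (ball_union_sphere (x := z) (ε := ρ) ▸ hx).resolve_right hsphere
  exact ⟨ε, hε, x, hball, by linarith [mul_nonneg hε.le hwz],
    hxmin.isLocalMin (mem_of_superset (isOpen_ball.mem_nhds hball) ball_subset_closedBall)⟩

variable {E : Type*} [NormedAddCommGroup E]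

/-- The radial barrier `exp (-a ‖x - q‖²)` of Hopf's argument. -/
noncomputable def hopfBarrier (a : ℝ) (q x : E) : ℝ :=
  Real.exp (-a * ‖x - q‖ ^ 2)

theorem hopfBarrier_pos (a : ℝ) (q x : E) : 0 < hopfBarrier a q x := Real.exp_pos _

theorem hopfBarrier_le_hopfBarrier_iff {a : ℝ} (ha : 0 < a) {q x y : E} :
    hopfBarrier a q x ≤ hopfBarrier a q y ↔ dist y q ≤ dist x q := by
  rw [hopfBarrier, hopfBarrier, Real.exp_le_exp, mul_le_mul_left_of_neg (neg_lt_zero.2 ha),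
    sq_le_sq₀ (norm_nonneg _) (norm_nonneg _), dist_eq_norm, dist_eq_norm]

variable [InnerProductSpace ℝ E]

theorem contDiff_hopfBarrier (a : ℝ) (q : E) : ContDiff ℝ 2 (hopfBarrier a q) :=
  (contDiff_const.mul ((contDiff_id.sub contDiff_const).norm_sq ℝ)).exp

theorem hasFDerivAt_hopfBarrier (a : ℝ) (q x : E) :
    HasFDerivAt (hopfBarrier a q) ((-2 * a * hopfBarrier a q x) • innerSL ℝ (x - q)) x := by
  refine ((((hasFDerivAt_id x).sub_const q).norm_sq).const_mul (-a)).exp.congr_fderiv ?_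
  ext v
  simp only [id_eq, neg_mul, map_sub, ContinuousLinearMap.comp_id, neg_smul, smul_neg, neg_apply,
    smul_apply, sub_apply, coe_innerSL_apply, nsmul_eq_mul, Nat.cast_ofNat, smul_eq_mul,
    hopfBarrier, neg_inj]
  ring

theorem fderiv_fderiv_hopfBarrier (a : ℝ) (q x v : E) :
    fderiv ℝ (fderiv ℝ (hopfBarrier a q)) x v v =
      hopfBarrier a q x * (4 * a ^ 2 * inner ℝ (x - q) v ^ 2 - 2 * a * ‖v‖ ^ 2) := by
  have hfirst : fderiv ℝ (hopfBarrier a q) =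
      fun x => (-2 * a * hopfBarrier a q x) • innerSL ℝ (x - q) :=
    funext fun x => (hasFDerivAt_hopfBarrier a q x).fderiv
  have hinner : HasFDerivAt (fun x => innerSL ℝ (x - q)) (innerSL ℝ) x :=
    (innerSL ℝ).hasFDerivAt.comp x ((hasFDerivAt_id x).sub_const q)
  have hsecond := ((hasFDerivAt_hopfBarrier a q x).const_mul (-2 * a)).fun_smul hinner
  rw [hfirst, hsecond.fderiv]
  simp only [add_apply, smul_apply, ContinuousLinearMap.smulRight_apply, innerSL_apply_apply,
    smul_eq_mul]
  have hself : innerSL ℝ v v = ‖v‖ ^ 2 := real_inner_self_eq_norm_sq v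
  linear_combination (-2 * a * hopfBarrier a q x) * hself

theorem exists_forall_mul_lt_ellipticOperator_hopfBarrier {ι : Type*} [Fintype ι] {K : Set E}
    (hK : IsCompact K) {q : E} (hq : q ∉ K) {V : ι → E → E} (hV : ∀ k, ContinuousOn (V k) K)
    (hspan : ∀ x ∈ K, ∀ d : E, d ≠ 0 → ∃ k, inner ℝ d (V k x) ≠ 0)
    {b : E → E} (hb : ContinuousOn b K) (C : ℝ) :
    ∃ a > 0, ∀ x ∈ K, C * hopfBarrier a q x < ellipticOperator V b 0 (hopfBarrier a q) x := by
  obtain ⟨m, hm, hmK⟩ : ∃ m > 0, ∀ x ∈ K, m ≤ ∑ k, inner ℝ (x - q) (V k x) ^ 2 := by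
    refine hK.exists_forall_le' (continuousOn_finsetSum _ fun k _ => ?_) fun x hx => ?_
    · have := hV k
      fun_prop
    · obtain ⟨k, hk⟩ := hspan x hx _ (sub_ne_zero.2 fun h : x = q => hq (h ▸ hx))
      exact Finset.sum_pos' (fun _ _ => sq_nonneg _) ⟨k, Finset.mem_univ k, by positivity⟩
  obtain ⟨B, hB⟩ : ∃ B, ∀ x ∈ K, ‖∑ k, ‖V k x‖ ^ 2 + inner ℝ (x - q) (b x)‖ ≤ B := by
    refine hK.exists_bound_of_continuousOn (ContinuousOn.add ?_ (by fun_prop))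
    exact continuousOn_finsetSum _ fun k _ => (hV k).norm.pow 2
  obtain ⟨a, ha₁, ha⟩ : ∃ a : ℝ, 1 ≤ a ∧ 2 * |B| + |C| < 4 * m * a := by
    obtain ⟨a, ha⟩ := exists_gt (max 1 ((2 * |B| + |C|) / (4 * m)))
    rw [max_lt_iff, div_lt_iff₀' (by positivity)] at ha
    exact ⟨a, ha.1.le, ha.2⟩
  have hmain : C < 4 * a ^ 2 * m - 2 * a * B := by
    nlinarith [le_abs_self B, le_abs_self C, abs_nonneg B, abs_nonneg C]
  refine ⟨a, by linarith, fun x hx => ?_⟩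
  have hformula : ellipticOperator V b 0 (hopfBarrier a q) x =
      (4 * a ^ 2 * ∑ k, inner ℝ (x - q) (V k x) ^ 2
        - 2 * a * (∑ k, ‖V k x‖ ^ 2 + inner ℝ (x - q) (b x))) * hopfBarrier a q x := by
    simp only [ellipticOperator, fderiv_fderiv_hopfBarrier, (hasFDerivAt_hopfBarrier a q x).fderiv,
      ← Finset.mul_sum, Finset.sum_sub_distrib, smul_apply, innerSL_apply_apply,
      smul_eq_mul, Pi.zero_apply]
    ring
  rw [hformula]
  refine mul_lt_mul_of_pos_right (hmain.trans_le ?_) (hopfBarrier_pos a q x)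
  have := hmK x hx
  have := (le_abs_self _).trans (hB x hx)
  gcongr

theorem dist_lt_dist_of_mem_closedBall_midpoint {x y z : E}
    (hx : x ∈ closedBall (midpoint ℝ y z) (dist y z / 2)) (hxz : x ≠ z) :
    dist x y < dist y z := by
  have hparallelogram := parallelogram_law_with_norm ℝ (x - midpoint ℝ y z) ((2⁻¹ : ℝ) • (z - y))
  have hy : x - midpoint ℝ y z + (2⁻¹ : ℝ) • (z - y) = x - y := by
    rw [midpoint_eq_smul_add, invOf_eq_inv]
    module
  have hz : x - midpoint ℝ y z - (2⁻¹ : ℝ) • (z - y) = x - z := by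
    rw [midpoint_eq_smul_add, invOf_eq_inv]
    module
  rw [hy, hz, norm_smul, ← dist_eq_norm z y, dist_comm z y, ← dist_eq_norm, ← dist_eq_norm,
    ← dist_eq_norm, Real.norm_of_nonneg (by norm_num)] at hparallelogram
  rw [mem_closedBall] at hx
  nlinarith [dist_pos.2 hxz, dist_nonneg (x := x) (y := y), dist_nonneg (x := y) (y := z),
    dist_nonneg (x := x) (y := midpoint ℝ y z)]

theorem exists_touching_ball_of_not_eventually_eq_zero [ProperSpace E] {U : Set E} (hU : IsOpen U)
    {u : E → ℝ} (hu : ContinuousOn u U) (hnonneg : ∀ x ∈ U, 0 ≤ u x) {p : E} (hp : p ∈ U)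
    (hup : u p = 0) (hne : ¬∀ᶠ x in 𝓝 p, u x = 0) :
    ∃ q, ∃ z ∈ U, z ≠ q ∧ u z = 0 ∧ ∀ x ∈ closedBall q (dist z q), x ≠ z → 0 < u x := by
  obtain ⟨r, hr, hrU⟩ := nhds_basis_closedBall.mem_iff.1 (hU.mem_nhds hp)
  obtain ⟨y, hyp, huy⟩ : ∃ y, dist y p < r / 2 ∧ u y ≠ 0 := by
    by_contra! h
    exact hne (mem_of_superset (ball_mem_nhds p (half_pos hr)) h)
  have hZcpt : IsCompact (closedBall p r ∩ u ⁻¹' {0}) :=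
    (isCompact_closedBall p r).of_isClosed_subset
      ((hu.mono hrU).preimage_isClosed_of_isClosed isClosed_closedBall isClosed_singleton)
      Set.inter_subset_left
  have hpZ : p ∈ closedBall p r ∩ u ⁻¹' {0} := ⟨mem_closedBall_self hr.le, hup⟩
  obtain ⟨z, ⟨hzr, huz⟩, hzmin⟩ := hZcpt.exists_isMinOn ⟨p, hpZ⟩ (f := dist y) (by fun_prop)
  have hyz : dist y z ≤ dist y p := hzmin hpZ
  have hpos : ∀ x, dist x y < dist y z → 0 < u x := by
    intro x hx
    have hxr : x ∈ closedBall p r := by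
      rw [mem_closedBall]
      linarith [dist_triangle x y p]
    refine (hnonneg x (hrU hxr)).lt_of_ne' fun hux => hx.not_ge ?_
    rw [dist_comm x y]
    exact hzmin ⟨hxr, hux⟩
  have hzy : z ≠ y := fun h => huy (h ▸ huz)
  refine ⟨midpoint ℝ y z, z, hrU hzr, ?_, huz, fun x hx hxz => ?_⟩
  · simpa using hzy.symm
  · rw [dist_right_midpoint, Real.norm_two, inv_mul_eq_div] at hx
    exact hpos x (dist_lt_dist_of_mem_closedBall_midpoint hx hxz)

theorem eventually_eq_zero_of_ellipticOperator_nonpos [FiniteDimensional ℝ E] {ι : Type*}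
    [Fintype ι] {U : Set E} (hU : IsOpen U) {V : ι → E → E} (hV : ∀ k, ContinuousOn (V k) U)
    (hspan : ∀ x ∈ U, ∀ d : E, d ≠ 0 → ∃ k, inner ℝ d (V k x) ≠ 0)
    {b : E → E} (hb : ContinuousOn b U) {c : E → ℝ} (hc : ContinuousOn c U)
    {u : E → ℝ} (hu : ContDiffOn ℝ 2 u U) (hsuper : ∀ x ∈ U, ellipticOperator V b c u x ≤ 0)
    (hnonneg : ∀ x ∈ U, 0 ≤ u x) {p : E} (hp : p ∈ U) (hup : u p = 0) :
    ∀ᶠ x in 𝓝 p, u x = 0 := by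
  by_contra hne
  obtain ⟨q, z, hzU, hzq, huz, hpos⟩ :=
    exists_touching_ball_of_not_eventually_eq_zero hU hu.continuousOn hnonneg hp hup hne
  obtain ⟨ρ, hρ, hρU, hρq⟩ : ∃ ρ > 0, closedBall z ρ ⊆ U ∧ q ∉ closedBall z ρ := by
    have hnhds : U ∩ {q}ᶜ ∈ 𝓝 z := inter_mem (hU.mem_nhds hzU) (isOpen_ne.mem_nhds hzq)
    obtain ⟨ρ, hρ, hsub⟩ := nhds_basis_closedBall.mem_iff.1 hnhds
    exact ⟨ρ, hρ, fun x hx => (hsub hx).1, fun hq => (hsub hq).2 rfl⟩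
  have hcpt : IsCompact (closedBall z ρ) := isCompact_closedBall z ρ
  obtain ⟨C, hC⟩ := hcpt.exists_bound_of_continuousOn (hc.mono hρU)
  obtain ⟨a, ha, hbarrier⟩ := exists_forall_mul_lt_ellipticOperator_hopfBarrier hcpt hρq
    (fun k => (hV k).mono hρU) (fun x hx => hspan x (hρU hx)) (hb.mono hρU) C
  -- Off `z` the function `u` is positive where the barrier exceeds its value at `z`, which keeps
  -- the minimum of `u - ε • hopfBarrier a q` away from the sphere.
  obtain ⟨ε, hε, x, hx, hux, hmin⟩ := exists_isLocalMin_sub_const_mul (w := hopfBarrier a q) hρ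
    (hu.continuousOn.mono hρU) (contDiff_hopfBarrier a q).continuous.continuousOn huz
    (hopfBarrier_pos a q z).le (fun x hx => hnonneg x (hρU hx)) fun x hx hzx =>
      hpos x ((hopfBarrier_le_hopfBarrier_iff ha).1 hzx) (ne_of_mem_sphere hx hρ.ne')
  have hxρ := ball_subset_closedBall hx
  have hxU := hρU hxρ
  exact (hsuper x hxU).not_gt (ellipticOperator_pos_of_isLocalMin_sub_const_smul
    (hu.contDiffAt (hU.mem_nhds hxU)) (contDiff_hopfBarrier a q).contDiffAt hε hmin
    (hnonneg x hxU) hux (hC x hxρ) (hbarrier x hxρ))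

end MinimumPrinciple

section PseudoInverse

open ContinuousLinearMap

variable {E F : Type*} [NormedAddCommGroup E] [InnerProductSpace ℝ E] [FiniteDimensional ℝ E]
  [NormedAddCommGroup F] [InnerProductSpace ℝ F] [CompleteSpace F] {A : E →L[ℝ] F}

/-- The Moore–Penrose inverse `(A† A)⁻¹ A†` of an injective continuous linear map `A`: the left
inverse of `A` that kills the orthogonal complement of its range. This expression is smooth
in `A`. -/
noncomputable def pseudoInverse (A : E →L[ℝ] F) : F →L[ℝ] E :=
  Ring.inverse (adjoint A ∘L A) ∘L adjoint A

theorem isUnit_adjoint_comp_self (hA : Function.Injective A) : IsUnit (adjoint A ∘L A) := by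
  have hinj : Function.Injective (adjoint A ∘L A) := (adjoint_comp_self_injective_iff A).2 hA
  exact isUnit_iff_bijective.2 ⟨hinj, LinearMap.injective_iff_surjective.1 hinj⟩

theorem adjoint_apply_pseudoInverse (hA : Function.Injective A) (y : F) :
    adjoint A (A (pseudoInverse A y)) = adjoint A y :=
  DFunLike.congr_fun (Ring.mul_inverse_cancel _ (isUnit_adjoint_comp_self hA)) (adjoint A y)

theorem inner_apply_pseudoInverse (hA : Function.Injective A) (y : F) (v : E) :
    inner ℝ (A (pseudoInverse A y)) (A v) = inner ℝ y (A v) := by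
  rw [← adjoint_inner_left, adjoint_apply_pseudoInverse hA, adjoint_inner_left]

theorem pseudoInverse_apply_self (hA : Function.Injective A) (v : E) :
    pseudoInverse A (A v) = v :=
  DFunLike.congr_fun (Ring.inverse_mul_cancel _ (isUnit_adjoint_comp_self hA)) v

theorem contDiffAt_pseudoInverse (hA : Function.Injective A) {m : WithTop ℕ∞} :
    ContDiffAt ℝ m pseudoInverse A := by
  have hadjoint : ContDiff ℝ m fun B : E →L[ℝ] F => adjoint B :=
    IsBoundedLinearMap.contDiff
      ⟨⟨fun B C => map_add (adjoint (𝕜 := ℝ) (E := E) (F := F)) B C,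
        fun c B => map_smulₛₗ (adjoint (𝕜 := ℝ) (E := E) (F := F)) c B⟩,
        1, one_pos, fun B => by rw [one_mul, LinearIsometryEquiv.norm_map]⟩
  obtain ⟨T, hT⟩ := isUnit_adjoint_comp_self hA
  have hinverse : ContDiffAt ℝ m Ring.inverse (adjoint A ∘L A) := hT ▸ contDiffAt_ringInverse ℝ T
  exact (hinverse.comp (f := fun B => adjoint B ∘L B) A
    (hadjoint.clm_comp contDiff_id).contDiffAt).clm_comp hadjoint.contDiffAt

theorem apply_pseudoInverse_add_inner_smul (hA : Function.Injective A)
    (hcodim : Module.finrank ℝ F = Module.finrank ℝ E + 1) {ν : F} (hν : ‖ν‖ = 1)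
    (hAν : ∀ v, inner ℝ (A v) ν = 0) (y : F) :
    A (pseudoInverse A y) + inner ℝ ν y • ν = y := by
  have : FiniteDimensional ℝ F := Module.finite_of_finrank_pos (by omega)
  have hmem (z : F) : z ∈ A.rangeᗮ ↔ ∀ v, inner ℝ (A v) z = 0 := by
    simp [Submodule.mem_orthogonal]
  have hrank : Module.finrank ℝ A.rangeᗮ = 1 := by
    have hsum := A.range.finrank_add_finrank_orthogonal
    rw [LinearMap.finrank_range_of_inj hA] at hsum
    omega
  have hν₀ : (⟨ν, (hmem ν).2 hAν⟩ : A.rangeᗮ) ≠ 0 := fun h => by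
    simp [show ν = 0 from congrArg Subtype.val h] at hν
  have hres : y - A (pseudoInverse A y) ∈ A.rangeᗮ := (hmem _).2 fun v => by
    rw [real_inner_comm, inner_sub_left, inner_apply_pseudoInverse hA, sub_self]
  obtain ⟨c, hc⟩ := (finrank_eq_one_iff_of_nonzero' _ hν₀).1 hrank ⟨_, hres⟩
  have hcν : c • ν = y - A (pseudoInverse A y) := congrArg Subtype.val hc
  have hy : y = A (pseudoInverse A y) + c • ν := by rw [hcν, add_sub_cancel]
  have hcoef : inner ℝ ν y = c := by
    rw [hy, inner_add_right, inner_smul_right, real_inner_self_eq_norm_sq, hν, real_inner_comm,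
      hAν]
    ring
  rw [hcoef, ← hy]

variable {ι : Type*} [Fintype ι] (b : OrthonormalBasis ι ℝ F)

theorem exists_inner_pseudoInverse_ne_zero (hA : Function.Injective A) {d : E} (hd : d ≠ 0) :
    ∃ k, inner ℝ d (pseudoInverse A (b k)) ≠ 0 := by
  by_contra! h
  have hzero : (innerSL ℝ d ∘L pseudoInverse A).toLinearMap = 0 := b.toBasis.ext (by simpa using h)
  have hself : inner ℝ d (pseudoInverse A (A d)) = 0 := DFunLike.congr_fun hzero (A d)
  exact hd (inner_self_eq_zero.1 (by rwa [pseudoInverse_apply_self hA] at hself))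

theorem sum_inner_apply_pseudoInverse (hA : Function.Injective A) (T : E →L[ℝ] E) :
    ∑ k, inner ℝ (A (T (pseudoInverse A (b k)))) (A (pseudoInverse A (b k))) =
      LinearMap.trace ℝ E T := by
  have hadjoint (k) : inner ℝ (A (T (pseudoInverse A (b k)))) (A (pseudoInverse A (b k))) =
      inner ℝ (b k) ((A.toLinearMap ∘ₗ (T ∘L pseudoInverse A).toLinearMap) (b k)) := by
    rw [real_inner_comm, inner_apply_pseudoInverse hA]
    rfl
  have hleft : (T ∘L pseudoInverse A).toLinearMap ∘ₗ A.toLinearMap = T.toLinearMap :=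
    LinearMap.ext fun v => congrArg T (pseudoInverse_apply_self hA v)
  have : FiniteDimensional ℝ F := b.toBasis.finiteDimensional_of_finite
  rw [Finset.sum_congr rfl fun k _ => hadjoint k, ← LinearMap.trace_eq_sum_inner _ b,
    LinearMap.trace_comp_comm', hleft]

theorem sum_inner_comp_apply_pseudoInverse (hA : Function.Injective A) {S : E →L[ℝ] E}
    (hS : ∀ u v, inner ℝ (A (S u)) (A v) = inner ℝ (A u) (A (S v))) (B : E →L[ℝ] F) :
    ∑ k, inner ℝ (B (S (pseudoInverse A (b k)))) (A (pseudoInverse A (b k))) =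
      ∑ k, inner ℝ (B (pseudoInverse A (b k))) (A (S (pseudoInverse A (b k)))) := by
  set P := pseudoInverse A
  calc
    _ = ∑ k, inner ℝ (A ((P ∘L B ∘L S) (P (b k)))) (A (P (b k))) :=
      Finset.sum_congr rfl fun k _ => (inner_apply_pseudoInverse hA _ _).symm
    _ = LinearMap.trace ℝ E ((P ∘L B).toLinearMap ∘ₗ S.toLinearMap) :=
      sum_inner_apply_pseudoInverse b hA (P ∘L B ∘L S)
    _ = LinearMap.trace ℝ E (S ∘L P ∘L B) :=
      LinearMap.trace_comp_comm' S.toLinearMap (P ∘L B).toLinearMap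
    _ = ∑ k, inner ℝ (A ((S ∘L P ∘L B) (P (b k)))) (A (P (b k))) :=
      (sum_inner_apply_pseudoInverse b hA (S ∘L P ∘L B)).symm
    _ = ∑ k, inner ℝ (B (P (b k))) (A (S (P (b k)))) :=
      Finset.sum_congr rfl fun k _ => (hS _ _).trans (inner_apply_pseudoInverse hA _ _)

end PseudoInverse

section HypersurfacePatch

open Filter Topology Module

section Equations

variable {E F : Type*} [NormedAddCommGroup E] [NormedSpace ℝ E]
  [NormedAddCommGroup F] [InnerProductSpace ℝ F]

theorem fderiv_inner_fderiv_apply {g h : E → F} {x : E} (hg : ContDiffAt ℝ 2 g x)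
    (hh : DifferentiableAt ℝ h x) (v w : E) :
    fderiv ℝ (fun y => inner ℝ (fderiv ℝ g y v) (h y)) x w =
      inner ℝ (fderiv ℝ (fderiv ℝ g) x w v) (h x) +
        inner ℝ (fderiv ℝ g x v) (fderiv ℝ h x w) := by
  have hdg : DifferentiableAt ℝ (fderiv ℝ g) x :=
    (hg.fderiv_right (m := 1) le_rfl).differentiableAt one_ne_zero
  have hdgv : HasFDerivAt (fun y => fderiv ℝ g y v) ((fderiv ℝ (fderiv ℝ g) x).flip v) x := by
    simpa using hdg.hasFDerivAt.clm_apply (hasFDerivAt_const v x)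
  rw [fderiv_inner_apply ℝ hdgv.differentiableAt hh, hdgv.fderiv, add_comm]
  rfl

theorem fderiv_inner_const_apply {g : E → F} {x : E} (hg : DifferentiableAt ℝ g x) (e : F) (v : E) :
    fderiv ℝ (fun y => inner ℝ (g y) e) x v = inner ℝ (fderiv ℝ g x v) e := by
  simp [fderiv_inner_apply ℝ hg (differentiableAt_const e)]

theorem fderiv_fderiv_inner_const {g : E → F} {x : E} (hg : ContDiffAt ℝ 2 g x) (e : F) (v w : E) :
    fderiv ℝ (fderiv ℝ fun y => inner ℝ (g y) e) x v w =
      inner ℝ (fderiv ℝ (fderiv ℝ g) x v w) e := by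
  have hdg : DifferentiableAt ℝ (fderiv ℝ g) x :=
    (hg.fderiv_right (m := 1) le_rfl).differentiableAt one_ne_zero
  have hfirst : fderiv ℝ (fun y => inner ℝ (g y) e) =ᶠ[𝓝 x]
      fun y => innerSL ℝ e ∘L fderiv ℝ g y := by
    filter_upwards [hg.eventually (by simp)] with y hy
    ext u
    rw [fderiv_inner_const_apply (hy.differentiableAt two_ne_zero), real_inner_comm]
    rfl
  rw [hfirst.fderiv_eq, ((hasFDerivAt_const (innerSL ℝ e) x).clm_comp hdg.hasFDerivAt).fderiv]
  simp [real_inner_comm]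

/-- A parametrized hypersurface with unit normal: an immersion `X` of an open set `U` into a
space of one dimension more, and a field `n` of unit normals along `X`, both of class `C²`. -/
structure IsHypersurfacePatch (U : Set E) (X n : E → F) : Prop where
  isOpen : IsOpen U
  contDiffOn : ContDiffOn ℝ 2 X U
  contDiffOn_normal : ContDiffOn ℝ 2 n U
  injective_fderiv : ∀ x ∈ U, Function.Injective (fderiv ℝ X x)
  norm_normal : ∀ x ∈ U, ‖n x‖ = 1
  inner_fderiv_normal : ∀ x ∈ U, ∀ v, inner ℝ (fderiv ℝ X x v) (n x) = 0
  finrank_eq : finrank ℝ F = finrank ℝ E + 1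

namespace IsHypersurfacePatch

variable {U : Set E} {X n : E → F} (hX : IsHypersurfacePatch U X n) {x : E} (hx : x ∈ U)
include hX hx

theorem contDiffAt : ContDiffAt ℝ 2 X x :=
  hX.contDiffOn.contDiffAt (hX.isOpen.mem_nhds hx)

theorem contDiffAt_normal : ContDiffAt ℝ 2 n x :=
  hX.contDiffOn_normal.contDiffAt (hX.isOpen.mem_nhds hx)

theorem inner_fderiv_normal_self (v : E) : inner ℝ (fderiv ℝ n x v) (n x) = 0 := by
  have hn := (hX.contDiffAt_normal hx).differentiableAt two_ne_zero
  have hunit : (fun y => inner ℝ (n y) (n y)) =ᶠ[𝓝 x] fun _ => (1 : ℝ) := by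
    filter_upwards [hX.isOpen.mem_nhds hx] with y hy
    rw [real_inner_self_eq_norm_sq, hX.norm_normal y hy, one_pow]
  have hderiv := DFunLike.congr_fun (hunit.fderiv_eq (𝕜 := ℝ)) v
  rw [fderiv_inner_apply ℝ hn hn, fderiv_fun_const, real_inner_comm, ← two_mul] at hderiv
  exact (mul_eq_zero.1 hderiv).resolve_left two_ne_zero

theorem inner_fderiv_fderiv_normal (u v : E) :
    inner ℝ (fderiv ℝ (fderiv ℝ X) x u v) (n x) = -inner ℝ (fderiv ℝ X x v) (fderiv ℝ n x u) := by
  have hn := (hX.contDiffAt_normal hx).differentiableAt two_ne_zero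
  have horth : (fun y => inner ℝ (fderiv ℝ X y v) (n y)) =ᶠ[𝓝 x] fun _ => (0 : ℝ) := by
    filter_upwards [hX.isOpen.mem_nhds hx] with y hy using hX.inner_fderiv_normal y hy v
  have hderiv := DFunLike.congr_fun (horth.fderiv_eq (𝕜 := ℝ)) u
  rw [fderiv_inner_fderiv_apply (hX.contDiffAt hx) hn, fderiv_fun_const] at hderiv
  exact eq_neg_of_add_eq_zero_left hderiv

theorem inner_fderiv_normal_fderiv_comm (u v : E) :
    inner ℝ (fderiv ℝ n x u) (fderiv ℝ X x v) = inner ℝ (fderiv ℝ n x v) (fderiv ℝ X x u) := by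
  have hsymm := (hX.contDiffAt hx).isSymmSndFDerivAt (by simp) u v
  have huv := hX.inner_fderiv_fderiv_normal hx u v
  rw [hsymm, hX.inner_fderiv_fderiv_normal hx, neg_inj] at huv
  rw [real_inner_comm, ← huv, real_inner_comm]

theorem codazzi (u v w : E) :
    inner ℝ (fderiv ℝ (fderiv ℝ n) x w u) (fderiv ℝ X x v) +
        inner ℝ (fderiv ℝ n x u) (fderiv ℝ (fderiv ℝ X) x w v) =
      inner ℝ (fderiv ℝ (fderiv ℝ n) x w v) (fderiv ℝ X x u) +
        inner ℝ (fderiv ℝ n x v) (fderiv ℝ (fderiv ℝ X) x w u) := by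
  have hdX : DifferentiableAt ℝ (fderiv ℝ X) x :=
    ((hX.contDiffAt hx).fderiv_right (m := 1) le_rfl).differentiableAt one_ne_zero
  have hdXv (z : E) : HasFDerivAt (fun y => fderiv ℝ X y z)
      ((fderiv ℝ (fderiv ℝ X) x).flip z) x := by
    simpa using hdX.hasFDerivAt.clm_apply (hasFDerivAt_const z x)
  have hcomm : (fun y => inner ℝ (fderiv ℝ n y u) (fderiv ℝ X y v)) =ᶠ[𝓝 x]
      fun y => inner ℝ (fderiv ℝ n y v) (fderiv ℝ X y u) := by
    filter_upwards [hX.isOpen.mem_nhds hx] with y hy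
    using hX.inner_fderiv_normal_fderiv_comm hy u v
  have hderiv := DFunLike.congr_fun (hcomm.fderiv_eq (𝕜 := ℝ)) w
  rw [fderiv_inner_fderiv_apply (hX.contDiffAt_normal hx) (hdXv v).differentiableAt,
    fderiv_inner_fderiv_apply (hX.contDiffAt_normal hx) (hdXv u).differentiableAt,
    (hdXv u).fderiv, (hdXv v).fderiv] at hderiv
  exact hderiv

theorem inner_fderiv_fderiv_normal_self (v : E) :
    inner ℝ (fderiv ℝ (fderiv ℝ n) x v v) (n x) = -‖fderiv ℝ n x v‖ ^ 2 := by
  have hn := hX.contDiffAt_normal hx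
  have horth : (fun y => inner ℝ (fderiv ℝ n y v) (n y)) =ᶠ[𝓝 x] fun _ => (0 : ℝ) := by
    filter_upwards [hX.isOpen.mem_nhds hx] with y hy using hX.inner_fderiv_normal_self hy v
  have hderiv := DFunLike.congr_fun (horth.fderiv_eq (𝕜 := ℝ)) v
  rw [fderiv_inner_fderiv_apply hn (hn.differentiableAt two_ne_zero), fderiv_fun_const,
    real_inner_self_eq_norm_sq] at hderiv
  exact eq_neg_of_add_eq_zero_left hderiv

end IsHypersurfacePatch

end Equations

variable {E F : Type*} [NormedAddCommGroup E] [InnerProductSpace ℝ E] [FiniteDimensional ℝ E]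
  [NormedAddCommGroup F] [InnerProductSpace ℝ F] [CompleteSpace F]
  {ι : Type*} [Fintype ι]

/-- The shape operator `S` of the parametrized hypersurface `X` with normal `n`, read in the
parameter domain, with the sign convention `dX ∘ S = dn`. The Moore–Penrose inverse of `dX` makes
it visibly as smooth as `dX` and `dn`. -/
noncomputable def shapeOperator (X n : E → F) (x : E) : E →L[ℝ] E :=
  pseudoInverse (fderiv ℝ X x) ∘L fderiv ℝ n x

/-- The tangential projections of the vectors of the orthonormal basis `b` onto the hypersurface
`X`, read in the parameter domain. They span every tangent space, and `∑ k, V k ⊗ V k` is the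
inverse metric, so that `u ↦ ∑ k, D²u (V k) (V k)` is the principal part of the Laplacian of
`X`. -/
noncomputable def tangentialFrame (b : OrthonormalBasis ι ℝ F) (X : E → F) (k : ι) (x : E) : E :=
  pseudoInverse (fderiv ℝ X x) (b k)

/-- The metric trace `∑ k, D²X (V k) (V k)` of the second derivative of `X`, taken in its
tangential frame. -/
noncomputable def traceHessian (b : OrthonormalBasis ι ℝ F) (X : E → F) (x : E) : F :=
  ∑ k, fderiv ℝ (fderiv ℝ X) x (tangentialFrame b X k x) (tangentialFrame b X k x)

namespace IsHypersurfacePatch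

variable {U : Set E} {X n : E → F} (hX : IsHypersurfacePatch U X n)
include hX

theorem contDiffOn_pseudoInverse_fderiv :
    ContDiffOn ℝ 1 (fun x => pseudoInverse (fderiv ℝ X x)) U := fun x hx =>
  ((contDiffAt_pseudoInverse (hX.injective_fderiv x hx)).comp x
    ((hX.contDiffAt hx).fderiv_right (m := 1) le_rfl)).contDiffWithinAt

theorem contDiffOn_shapeOperator : ContDiffOn ℝ 1 (shapeOperator X n) U :=
  hX.contDiffOn_pseudoInverse_fderiv.clm_comp
    (hX.contDiffOn_normal.fderiv_of_isOpen hX.isOpen le_rfl)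

variable {x : E} (hx : x ∈ U)
include hx

theorem fderiv_apply_pseudoInverse_add (y : F) :
    fderiv ℝ X x (pseudoInverse (fderiv ℝ X x) y) + inner ℝ (n x) y • n x = y :=
  apply_pseudoInverse_add_inner_smul (hX.injective_fderiv x hx) hX.finrank_eq
    (hX.norm_normal x hx) (hX.inner_fderiv_normal x hx) y

theorem fderiv_shapeOperator_apply (v : E) :
    fderiv ℝ X x (shapeOperator X n x v) = fderiv ℝ n x v := by
  have h := hX.fderiv_apply_pseudoInverse_add hx (fderiv ℝ n x v)
  rwa [real_inner_comm, hX.inner_fderiv_normal_self hx, zero_smul, add_zero] at h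

theorem inner_fderiv_shapeOperator_comm (u v : E) :
    inner ℝ (fderiv ℝ X x (shapeOperator X n x u)) (fderiv ℝ X x v) =
      inner ℝ (fderiv ℝ X x u) (fderiv ℝ X x (shapeOperator X n x v)) := by
  rw [hX.fderiv_shapeOperator_apply hx, hX.fderiv_shapeOperator_apply hx,
    hX.inner_fderiv_normal_fderiv_comm hx, real_inner_comm]

theorem fderiv_fderiv_normal (w v : E) :
    fderiv ℝ (fderiv ℝ n) x w v =
      fderiv ℝ (fderiv ℝ X) x w (shapeOperator X n x v) +
        fderiv ℝ X x (fderiv ℝ (shapeOperator X n) x w v) := by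
  have hdX : DifferentiableAt ℝ (fderiv ℝ X) x :=
    ((hX.contDiffAt hx).fderiv_right (m := 1) le_rfl).differentiableAt one_ne_zero
  have hS : DifferentiableAt ℝ (shapeOperator X n) x :=
    (hX.contDiffOn_shapeOperator.contDiffAt (hX.isOpen.mem_nhds hx)).differentiableAt one_ne_zero
  have hweingarten : fderiv ℝ n =ᶠ[𝓝 x] fun y => fderiv ℝ X y ∘L shapeOperator X n y := by
    filter_upwards [hX.isOpen.mem_nhds hx] with y hy
    using ContinuousLinearMap.ext fun v => (hX.fderiv_shapeOperator_apply hy v).symm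
  rw [hweingarten.fderiv_eq, (hdX.hasFDerivAt.clm_comp hS.hasFDerivAt).fderiv, add_comm]
  rfl

theorem fderiv_trace_shapeOperator (w : E) :
    fderiv ℝ (fun y => LinearMap.trace ℝ E (shapeOperator X n y)) x w =
      LinearMap.trace ℝ E (fderiv ℝ (shapeOperator X n) x w) := by
  have hS : DifferentiableAt ℝ (shapeOperator X n) x :=
    (hX.contDiffOn_shapeOperator.contDiffAt (hX.isOpen.mem_nhds hx)).differentiableAt one_ne_zero
  let traceCLM : (E →L[ℝ] E) →L[ℝ] ℝ :=
    (LinearMap.trace ℝ E ∘ₗ ContinuousLinearMap.coeLM ℝ).toContinuousLinearMap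
  exact DFunLike.congr_fun (traceCLM.hasFDerivAt.comp x hS.hasFDerivAt).fderiv w

variable (b : OrthonormalBasis ι ℝ F)

/-- The metric trace of the Codazzi equation: `⟨D²X(w, S V), dX V⟩` and `⟨dn V, D²X(V, w)⟩` cancel
in the trace because the shape operator `S` is self-adjoint. -/
theorem sum_inner_fderiv_fderiv_normal (w : E) :
    ∑ k, inner ℝ (fderiv ℝ (fderiv ℝ n) x (tangentialFrame b X k x) (tangentialFrame b X k x))
        (fderiv ℝ X x w) =
      fderiv ℝ (fun y => LinearMap.trace ℝ E (shapeOperator X n y)) x w +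
        inner ℝ (fderiv ℝ n x w) (traceHessian b X x) := by
  have hinj := hX.injective_fderiv x hx
  set V : ι → E := fun k => tangentialFrame b X k x
  set S := shapeOperator X n x
  set DS := fderiv ℝ (shapeOperator X n) x
  have hsymmX := (hX.contDiffAt hx).isSymmSndFDerivAt (by simp)
  have hsymmn := (hX.contDiffAt_normal hx).isSymmSndFDerivAt (by simp)
  have htrace : ∑ k, inner ℝ (fderiv ℝ X x (DS w (V k))) (fderiv ℝ X x (V k)) =
      fderiv ℝ (fun y => LinearMap.trace ℝ E (shapeOperator X n y)) x w :=
    (sum_inner_apply_pseudoInverse b hinj _).trans (hX.fderiv_trace_shapeOperator hx w).symm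
  have hselfAdjoint : ∑ k, inner ℝ (fderiv ℝ (fderiv ℝ X) x w (S (V k))) (fderiv ℝ X x (V k)) =
      ∑ k, inner ℝ (fderiv ℝ n x (V k)) (fderiv ℝ (fderiv ℝ X) x (V k) w) := by
    refine (sum_inner_comp_apply_pseudoInverse b hinj
      (hX.inner_fderiv_shapeOperator_comm hx) _).trans (Finset.sum_congr rfl fun k _ => ?_)
    rw [hX.fderiv_shapeOperator_apply hx, real_inner_comm, hsymmX]
    rfl
  have hcodazzi (k : ι) : inner ℝ (fderiv ℝ (fderiv ℝ n) x (V k) (V k)) (fderiv ℝ X x w) =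
      inner ℝ (fderiv ℝ (fderiv ℝ X) x w (S (V k))) (fderiv ℝ X x (V k)) +
        inner ℝ (fderiv ℝ X x (DS w (V k))) (fderiv ℝ X x (V k)) +
        inner ℝ (fderiv ℝ n x w) (fderiv ℝ (fderiv ℝ X) x (V k) (V k)) -
        inner ℝ (fderiv ℝ n x (V k)) (fderiv ℝ (fderiv ℝ X) x (V k) w) := by
    rw [← inner_add_left, ← hX.fderiv_fderiv_normal hx, hsymmn w]
    exact eq_sub_of_add_eq (hX.codazzi hx _ _ _)
  rw [Finset.sum_congr rfl fun k _ => hcodazzi k, Finset.sum_sub_distrib, Finset.sum_add_distrib,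
    Finset.sum_add_distrib, htrace, hselfAdjoint, ← inner_sum, traceHessian]
  ring

/-- The Jacobi equation of the translation in direction `e`. -/
theorem ellipticOperator_inner_normal (e : F) :
    ellipticOperator (tangentialFrame b X)
        (fun y => -pseudoInverse (fderiv ℝ X y) (traceHessian b X y))
        (fun y => ∑ k, ‖fderiv ℝ n y (tangentialFrame b X k y)‖ ^ 2)
        (fun y => inner ℝ (n y) e) x =
      fderiv ℝ (fun y => LinearMap.trace ℝ E (shapeOperator X n y)) x
        (pseudoInverse (fderiv ℝ X x) e) := by
  set P := pseudoInverse (fderiv ℝ X x)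
  set V : ι → E := fun k => tangentialFrame b X k x
  have hn := hX.contDiffAt_normal hx
  have hnd := hn.differentiableAt two_ne_zero
  have hdecomp (z : F) : inner ℝ z e =
      inner ℝ z (fderiv ℝ X x (P e)) + inner ℝ (n x) e * inner ℝ z (n x) := by
    conv_lhs => rw [← hX.fderiv_apply_pseudoInverse_add hx e]
    rw [inner_add_right, inner_smul_right]
  have hsecond (k : ι) : inner ℝ (fderiv ℝ (fderiv ℝ n) x (V k) (V k)) e =
      inner ℝ (fderiv ℝ (fderiv ℝ n) x (V k) (V k)) (fderiv ℝ X x (P e)) -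
        ‖fderiv ℝ n x (V k)‖ ^ 2 * inner ℝ (n x) e := by
    rw [hdecomp, hX.inner_fderiv_fderiv_normal_self hx]
    ring
  have hfirst : inner ℝ (fderiv ℝ n x (P (traceHessian b X x))) e =
      inner ℝ (fderiv ℝ n x (P e)) (traceHessian b X x) := by
    rw [hdecomp, hX.inner_fderiv_normal_self hx, mul_zero, add_zero,
      hX.inner_fderiv_normal_fderiv_comm hx, ← hX.fderiv_shapeOperator_apply hx, real_inner_comm,
      inner_apply_pseudoInverse (hX.injective_fderiv x hx), real_inner_comm]
  simp only [ellipticOperator, fderiv_fderiv_inner_const hn]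
  rw [Finset.sum_congr rfl fun k _ => hsecond k, Finset.sum_sub_distrib,
    hX.sum_inner_fderiv_fderiv_normal hx b, fderiv_inner_const_apply hnd, map_neg,
    inner_neg_left, hfirst, Finset.sum_mul]
  ring

theorem ellipticOperator_inner_normal_of_trace_eq {e : F} {ψ : E → ℝ}
    (hψ : DifferentiableAt ℝ ψ x)
    (htrace : ∀ y ∈ U, LinearMap.trace ℝ E (shapeOperator X n y) = -(ψ y * inner ℝ (n y) e)) :
    ellipticOperator (tangentialFrame b X)
      (fun y => ψ y • pseudoInverse (fderiv ℝ X y) e -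
        pseudoInverse (fderiv ℝ X y) (traceHessian b X y))
      (fun y => ∑ k, ‖fderiv ℝ n y (tangentialFrame b X k y)‖ ^ 2 +
        fderiv ℝ ψ y (pseudoInverse (fderiv ℝ X y) e))
      (fun y => inner ℝ (n y) e) x = 0 := by
  have hu : DifferentiableAt ℝ (fun y => inner ℝ (n y) e) x :=
    ((hX.contDiffAt_normal hx).differentiableAt two_ne_zero).inner ℝ (differentiableAt_const e)
  have htrace' : (fun y => LinearMap.trace ℝ E (shapeOperator X n y)) =ᶠ[𝓝 x]
      fun y => -(ψ y * inner ℝ (n y) e) := eventually_of_mem (hX.isOpen.mem_nhds hx) htrace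
  have hjacobi := hX.ellipticOperator_inner_normal hx b e
  rw [htrace'.fderiv_eq, fderiv_fun_neg, fderiv_fun_mul hψ hu] at hjacobi
  simp only [ellipticOperator, map_sub, map_smul, map_neg, smul_eq_mul, neg_apply, add_apply,
    smul_apply] at hjacobi ⊢
  linarith

end IsHypersurfacePatch

theorem IsHypersurfacePatch.eventually_inner_normal_eq_zero {U : Set E} {X n : E → F}
    (hX : IsHypersurfacePatch U X n) {e : F} {ψ : E → ℝ} (hψ : ContDiffOn ℝ 1 ψ U)
    (htrace : ∀ x ∈ U, LinearMap.trace ℝ E (shapeOperator X n x) = -(ψ x * inner ℝ (n x) e))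
    (hnonneg : ∀ x ∈ U, 0 ≤ inner ℝ (n x) e) {p : E} (hp : p ∈ U) (hzero : inner ℝ (n p) e = 0) :
    ∀ᶠ x in 𝓝 p, inner ℝ (n x) e = 0 := by
  have : FiniteDimensional ℝ F := finite_of_finrank_pos (by rw [hX.finrank_eq]; omega)
  let b := stdOrthonormalBasis ℝ F
  have hP (y : E → F) (hy : ContinuousOn y U) :
      ContinuousOn (fun x => pseudoInverse (fderiv ℝ X x) (y x)) U :=
    hX.contDiffOn_pseudoInverse_fderiv.continuousOn.clm_apply hy
  have hV (k) : ContinuousOn (tangentialFrame b X k) U := hP _ continuousOn_const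
  have hD2X := (hX.contDiffOn.fderiv_of_isOpen (m := 1) hX.isOpen
    le_rfl).continuousOn_fderiv_of_isOpen hX.isOpen le_rfl
  have hdn := hX.contDiffOn_normal.continuousOn_fderiv_of_isOpen hX.isOpen one_le_two
  have hW : ContinuousOn (traceHessian b X) U :=
    continuousOn_finsetSum _ fun k _ => (hD2X.clm_apply (hV k)).clm_apply (hV k)
  exact eventually_eq_zero_of_ellipticOperator_nonpos hX.isOpen hV
    (fun x hx d hd => exists_inner_pseudoInverse_ne_zero b (hX.injective_fderiv x hx) hd)
    ((hψ.continuousOn.smul (hP _ continuousOn_const)).sub (hP _ hW))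
    ((continuousOn_finsetSum _ fun k _ => (hdn.clm_apply (hV k)).norm.pow 2).add
      ((hψ.continuousOn_fderiv_of_isOpen hX.isOpen le_rfl).clm_apply (hP _ continuousOn_const)))
    (hX.contDiffOn_normal.inner ℝ contDiffOn_const)
    (fun x hx => (hX.ellipticOperator_inner_normal_of_trace_eq hx b
      ((hψ.contDiffAt (hX.isOpen.mem_nhds hx)).differentiableAt one_ne_zero) htrace).le)
    hnonneg hp hzero

theorem comp_self_eq_zero_of_trace_eq_zero_of_det_eq_zero {R V : Type*} [CommRing R]
    [AddCommGroup V] [Module R V] (b : Basis (Fin 2) R V) {T : V →ₗ[R] V}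
    (htrace : LinearMap.trace R V T = 0) (hdet : LinearMap.det T = 0) : T ∘ₗ T = 0 := by
  rw [LinearMap.trace_eq_matrix_trace R b, Matrix.trace_fin_two] at htrace
  rw [← LinearMap.det_toMatrix b, Matrix.det_fin_two] at hdet
  refine (LinearMap.toMatrix b b).injective ?_
  rw [LinearMap.toMatrix_comp b b b, map_zero]
  ext i j
  fin_cases i <;> fin_cases j <;>
    simp only [Matrix.mul_apply, Fin.sum_univ_two, Fin.zero_eta, Fin.mk_one,
      Matrix.zero_apply] <;> grind

theorem IsHypersurfacePatch.fderiv_normal_eq_zero {U : Set E} {X n : E → F}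
    (hX : IsHypersurfacePatch U X n) (hE : finrank ℝ E = 2) {e : F} (he : e ≠ 0)
    (horth : ∀ x ∈ U, inner ℝ (n x) e = 0) {x : E} (hx : x ∈ U)
    (htrace : LinearMap.trace ℝ E (shapeOperator X n x) = 0) : fderiv ℝ n x = 0 := by
  have hinj := hX.injective_fderiv x hx
  set S := shapeOperator X n x with hS
  set t := pseudoInverse (fderiv ℝ X x) e
  have hXt : fderiv ℝ X x t = e := by
    simpa only [horth x hx, zero_smul, add_zero] using hX.fderiv_apply_pseudoInverse_add hx e
  have ht : t ≠ 0 := fun h => he (by rw [← hXt, h, map_zero])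
  have horth' : (fun y => inner ℝ (n y) e) =ᶠ[𝓝 x] fun _ => 0 :=
    eventually_of_mem (hX.isOpen.mem_nhds hx) horth
  have hderiv (v : E) : inner ℝ (fderiv ℝ n x v) e = 0 := by
    rw [← fderiv_inner_const_apply ((hX.contDiffAt_normal hx).differentiableAt two_ne_zero),
      horth'.fderiv_eq, fderiv_fun_const, Pi.zero_apply, zero_apply]
  have hSt : S t = 0 := by
    refine hinj ?_
    rw [map_zero, ← inner_self_eq_zero (𝕜 := ℝ)]
    nth_rw 1 [hX.fderiv_shapeOperator_apply hx]
    rw [hX.inner_fderiv_normal_fderiv_comm hx, hXt, hderiv]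
  have hdet : LinearMap.det S.toLinearMap = 0 := LinearMap.det_eq_zero_iff_ker_ne_bot.2
    ((Submodule.ne_bot_iff _).2 ⟨t, hSt, ht⟩)
  have hSS (v : E) : S (S v) = 0 := DFunLike.congr_fun
    (comp_self_eq_zero_of_trace_eq_zero_of_det_eq_zero (finBasisOfFinrankEq ℝ E hE) htrace hdet) v
  ext v
  rw [← hX.fderiv_shapeOperator_apply hx, zero_apply, ← inner_self_eq_zero (𝕜 := ℝ),
    ← hX.inner_fderiv_shapeOperator_comm hx, ← hS, hSS, map_zero, inner_zero_left]

end HypersurfacePatch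

section ChartDifferential

open Topology

variable {E V M : Type*} [NormedAddCommGroup E] [NormedSpace ℝ E] [NormedAddCommGroup V]
  [NormedSpace ℝ V] [TopologicalSpace M] [ChartedSpace E M]

theorem contDiffOn_comp_chart_symm {m : WithTop ℕ∞} [IsManifold 𝓘(ℝ, E) m M] {k : M → V}
    (hk : ContMDiff 𝓘(ℝ, E) 𝓘(ℝ, V) m k) (p : M) :
    ContDiffOn ℝ m (k ∘ (chartAt E p).symm) (chartAt E p).target :=
  contMDiffOn_iff_contDiffOn.1 (hk.comp_contMDiffOn (contMDiffOn_chart_symm (I := 𝓘(ℝ, E))))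

variable [IsManifold 𝓘(ℝ, E) 1 M]

theorem exists_hasFDerivAt_comp_chart_symm (p : M) {x : E} (hx : x ∈ (chartAt E p).target) :
    ∃ J : E ≃L[ℝ] E, ∀ (k : M → V) (k' : E →L[ℝ] V),
      HasMFDerivAt 𝓘(ℝ, E) 𝓘(ℝ, V) k ((chartAt E p).symm x) k' →
        HasFDerivAt (k ∘ (chartAt E p).symm) (k' ∘L J) x := by
  have hchart : (chartAt E p).MDifferentiable 𝓘(ℝ, E) 𝓘(ℝ, E) :=
    mdifferentiable_of_mem_atlas (chart_mem_atlas E p)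
  exact ⟨hchart.symm.mfderiv hx, fun k k' hk =>
    (hk.comp x (hchart.mdifferentiableAt_symm hx).hasMFDerivAt).hasFDerivAt⟩

theorem eq_of_hasMFDerivAt_zero [PreconnectedSpace M] {k : M → V}
    (hk : ∀ p, HasMFDerivAt 𝓘(ℝ, E) 𝓘(ℝ, V) k p (0 : E →L[ℝ] V)) (p q : M) : k p = k q := by
  have hderiv (p : M) {x : E} (hx : x ∈ (chartAt E p).target) :
      HasFDerivAt (k ∘ (chartAt E p).symm) (0 : E →L[ℝ] V) x := by
    obtain ⟨J, hJ⟩ := exists_hasFDerivAt_comp_chart_symm (V := V) p hx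
    simpa using hJ k 0 (hk _)
  suffices IsLocallyConstant k from this.apply_eq_of_preconnectedSpace p q
  refine (IsLocallyConstant.iff_eventually_eq k).2 fun p => ?_
  have hp := mem_chart_source E p
  obtain ⟨r, hr, hball⟩ := Metric.isOpen_iff.1 (chartAt E p).open_target _ (mem_chart_target E p)
  filter_upwards [(chartAt E p).open_source.mem_nhds hp,
    ((chartAt E p).continuousAt hp).eventually (Metric.ball_mem_nhds _ hr)] with y hy hyr
  have hconst := Metric.isOpen_ball.is_const_of_fderiv_eq_zero
    (convex_ball (chartAt E p p) r).isPreconnected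
    (fun x hx => (hderiv p (hball hx)).differentiableAt.differentiableWithinAt)
    (fun x hx => (hderiv p (hball hx)).fderiv) hyr (Metric.mem_ball_self hr)
  simpa only [Function.comp_apply, (chartAt E p).left_inv hy, (chartAt E p).left_inv hp]
    using hconst

end ChartDifferential

section MeanCurvature

open Module

theorem trace_inv_gram_mul {ι E F : Type*} [Fintype ι] [DecidableEq ι] [AddCommGroup E] [Module ℝ E]
    [NormedAddCommGroup F] [InnerProductSpace ℝ F] (b : Basis ι ℝ E) {A : E →ₗ[ℝ] F}
    (hA : Function.Injective A) (S : E →ₗ[ℝ] E) :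
    ((Matrix.gram ℝ (A ∘ b))⁻¹ * Matrix.of fun i j => inner ℝ (A (S (b i))) (A (b j))).trace =
      LinearMap.trace ℝ E S := by
  have hdet : IsUnit (Matrix.gram ℝ (A ∘ b)).det := isUnit_iff_ne_zero.2
    (Matrix.det_gram_ne_zero_iff_linearIndependent.2
      (b.linearIndependent.map' A (LinearMap.ker_eq_bot.2 hA)))
  have hmul : (Matrix.of fun i j => inner ℝ (A (S (b i))) (A (b j))) =
      (LinearMap.toMatrix b b S).transpose * Matrix.gram ℝ (A ∘ b) := by
    ext i j
    conv_lhs => rw [Matrix.of_apply, ← b.sum_repr (S (b i)), map_sum, sum_inner]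
    simp [Matrix.mul_apply, inner_smul_left, LinearMap.toMatrix_apply]
  rw [hmul, Matrix.trace_mul_comm, Matrix.mul_nonsing_inv_cancel_right _ _ hdet,
    Matrix.trace_transpose, ← LinearMap.trace_eq_matrix_trace]

local notation "E2" => EuclideanSpace ℝ (Fin 2)

variable {M : Type*} [TopologicalSpace M] [ChartedSpace E2 M] {f N : M → E3}

theorem meanCurvature_eq_trace {p : M} (hf : Function.Injective (surfDiff f p)) {S : E2 →L[ℝ] E2}
    (hS : ∀ v, surfDiff f p (S v) = surfDiff N p v) :
    meanCurvature f N p = LinearMap.trace ℝ E2 S := by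
  have hbasis (i : Fin 2) : (EuclideanSpace.basisFun (Fin 2) ℝ).toBasis i = coordVec i := by
    simp [coordVec]
  have htrace := trace_inv_gram_mul (EuclideanSpace.basisFun (Fin 2) ℝ).toBasis
    (A := (surfDiff f p).toLinearMap) hf S
  simp only [Matrix.gram, Function.comp_apply, hbasis, ContinuousLinearMap.coe_coe, hS] at htrace
  exact htrace

theorem hasMFDerivAt_surfDiff {k : M → E3} (hk : ContMDiff (𝓡 2) 𝓘(ℝ, E3) ∞ k) (p : M) :
    HasMFDerivAt (𝓡 2) 𝓘(ℝ, E3) k p (surfDiff k p) :=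
  (hk.mdifferentiableAt (by simp)).hasMFDerivAt

theorem IsPhiMinimal.meanCurvature_eq_neg_deriv_mul {φ : ℝ → ℝ} {I : Set ℝ}
    (hf : IsPhiMinimal φ I f N) (hI : IsOpen I) (hφ : DifferentiableOn ℝ φ I) (p : M) :
    meanCurvature f N p = -(deriv φ (f p 2) * inner ℝ (N p) e3) := by
  have hheight : HasFDerivAt (fun x : E3 => φ (x 2))
      (deriv φ (f p 2) • EuclideanSpace.proj (𝕜 := ℝ) 2) (f p) :=
    (hφ.differentiableAt (hI.mem_nhds (hf.mem_slab p))).hasDerivAt.comp_hasFDerivAt (f p)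
      (EuclideanSpace.proj (𝕜 := ℝ) (2 : Fin 3)).hasFDerivAt
  rw [hf.meanCurvature_eq, inner_gradient_left, hheight.fderiv]
  simp [e3, EuclideanSpace.inner_single_right]

variable [IsManifold (𝓡 2) ∞ M]

theorem IsSmoothImmersion.isHypersurfacePatch (hf : IsSmoothImmersion f) (hN : IsGaussMap f N)
    (p : M) :
    IsHypersurfacePatch (chartAt E2 p).target (f ∘ (chartAt E2 p).symm)
      (N ∘ (chartAt E2 p).symm) := by
  have hderiv {x : E2} (hx : x ∈ (chartAt E2 p).target) : ∃ J : E2 ≃L[ℝ] E2,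
      fderiv ℝ (f ∘ (chartAt E2 p).symm) x = surfDiff f ((chartAt E2 p).symm x) ∘L J := by
    obtain ⟨J, hJ⟩ := exists_hasFDerivAt_comp_chart_symm (V := E3) p hx
    exact ⟨J, (hJ f _ (hasMFDerivAt_surfDiff hf.smooth _)).fderiv⟩
  have htwo : (2 : WithTop ℕ∞) ≤ ∞ := WithTop.coe_le_coe.2 le_top
  refine ⟨(chartAt E2 p).open_target, (contDiffOn_comp_chart_symm hf.smooth p).of_le htwo,
    (contDiffOn_comp_chart_symm hN.smooth p).of_le htwo, fun x hx => ?_,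
    fun x _ => hN.norm_eq_one _, fun x hx v => ?_, by simp⟩
  · obtain ⟨J, hJ⟩ := hderiv hx
    rw [hJ]
    exact (hf.injective_diff _).comp J.injective
  · obtain ⟨J, hJ⟩ := hderiv hx
    rw [hJ]
    exact hN.normal _ _

theorem IsSmoothImmersion.trace_shapeOperator (hf : IsSmoothImmersion f) (hN : IsGaussMap f N)
    (p : M) {x : E2} (hx : x ∈ (chartAt E2 p).target) :
    LinearMap.trace ℝ E2 (shapeOperator (f ∘ (chartAt E2 p).symm) (N ∘ (chartAt E2 p).symm) x) =
      meanCurvature f N ((chartAt E2 p).symm x) := by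
  obtain ⟨J, hJ⟩ := exists_hasFDerivAt_comp_chart_symm (V := E3) p hx
  have hweingarten := (hf.isHypersurfacePatch hN p).fderiv_shapeOperator_apply hx
  rw [(hJ f _ (hasMFDerivAt_surfDiff hf.smooth _)).fderiv,
    (hJ N _ (hasMFDerivAt_surfDiff hN.smooth _)).fderiv] at hweingarten
  set S := shapeOperator (f ∘ (chartAt E2 p).symm) (N ∘ (chartAt E2 p).symm) x
  have hS (v : E2) : surfDiff f ((chartAt E2 p).symm x) ((J ∘L S ∘L J.symm) v) =
      surfDiff N ((chartAt E2 p).symm x) v := by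
    simpa using hweingarten (J.symm v)
  rw [meanCurvature_eq_trace (hf.injective_diff _) hS]
  exact (LinearMap.trace_conj' S.toLinearMap J.toLinearEquiv).symm

theorem IsSmoothImmersion.surfDiff_normal_eq_zero (hf : IsSmoothImmersion f) (hN : IsGaussMap f N)
    (hH : ∀ p, meanCurvature f N p = 0) {e : E3} (he : e ≠ 0) (horth : ∀ p, inner ℝ (N p) e = 0)
    (p : M) : surfDiff N p = 0 := by
  have hx := mem_chart_target E2 p
  obtain ⟨J, hJ⟩ := exists_hasFDerivAt_comp_chart_symm (V := E3) p hx
  have hflat : fderiv ℝ (N ∘ (chartAt E2 p).symm) (chartAt E2 p p) = 0 :=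
    (hf.isHypersurfacePatch hN p).fderiv_normal_eq_zero (by simp) he (fun x _ => horth _) hx
      ((hf.trace_shapeOperator hN p hx).trans (hH _))
  rw [(hJ N _ (hasMFDerivAt_surfDiff hN.smooth _)).fderiv,
    (chartAt E2 p).left_inv (mem_chart_source E2 p)] at hflat
  ext1 v
  simpa using DFunLike.congr_fun hflat (J.symm v)

variable [PreconnectedSpace M]

theorem IsSmoothImmersion.inner_eq_of_surfDiff_normal_eq_zero (hf : IsSmoothImmersion f)
    (hN : IsGaussMap f N) (hdN : ∀ p, surfDiff N p = 0) (p q : M) :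
    inner ℝ (N p) (f p) = inner ℝ (N p) (f q) := by
  have : IsManifold (𝓡 2) 1 M := .of_le (n := ∞) (by simp)
  have hconst (q : M) : N q = N p :=
    eq_of_hasMFDerivAt_zero (E := E2) (fun q => hdN q ▸ hasMFDerivAt_surfDiff hN.smooth q) q p
  refine eq_of_hasMFDerivAt_zero (E := E2) (k := fun q => inner ℝ (N p) (f q)) (fun q => ?_) p q
  have hinner := (innerSL ℝ (N p)).hasMFDerivAt.comp q (hasMFDerivAt_surfDiff hf.smooth q)
  have hzero : innerSL ℝ (N p) ∘L surfDiff f q = 0 := by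
    ext1 v
    simpa [real_inner_comm, hconst q] using hN.normal q v
  rw [← hzero]
  exact hinner

theorem IsPhiMinimal.inner_e3_eq_zero {φ : ℝ → ℝ} {I : Set ℝ} (hf : IsPhiMinimal φ I f N)
    (hI : IsOpen I) (hφ : ContDiffOn ℝ 2 φ I) (hnonneg : ∀ p, 0 ≤ inner ℝ (N p) e3)
    (hzero : ∃ p, inner ℝ (N p) e3 = 0) (p : M) : inner ℝ (N p) e3 = 0 := by
  have hclosed : IsClosed {p | inner ℝ (N p) e3 = 0} :=
    isClosed_eq (hf.gaussMap.smooth.continuous.inner continuous_const) continuous_const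
  have hopen : IsOpen {p | inner ℝ (N p) e3 = 0} := by
    refine isOpen_iff_mem_nhds.2 fun p hp => ?_
    have hsource := mem_chart_source E2 p
    have hpatch := hf.immersion.isHypersurfacePatch hf.gaussMap p
    have hψ : ContDiffOn ℝ 1 (fun x => deriv φ (f ((chartAt E2 p).symm x) 2))
        (chartAt E2 p).target :=
      (hφ.deriv_of_isOpen hI le_rfl).comp ((EuclideanSpace.proj (𝕜 := ℝ)
        (2 : Fin 3)).contDiff.comp_contDiffOn (hpatch.contDiffOn.of_le one_le_two))
        fun x _ => hf.mem_slab _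
    have hlocal := hpatch.eventually_inner_normal_eq_zero hψ
      (fun x hx => (hf.immersion.trace_shapeOperator hf.gaussMap p hx).trans
        (hf.meanCurvature_eq_neg_deriv_mul hI (hφ.differentiableOn two_ne_zero) _))
      (fun x _ => hnonneg _) (mem_chart_target E2 p)
      (by rwa [Function.comp_apply, (chartAt E2 p).left_inv hsource])
    filter_upwards [(chartAt E2 p).open_source.mem_nhds hsource,
      ((chartAt E2 p).continuousAt hsource).eventually hlocal] with q hq hzero
    rwa [Function.comp_apply, (chartAt E2 p).left_inv hq] at hzero
  exact Set.eq_univ_iff_forall.1 (IsClopen.eq_univ ⟨hclosed, hopen⟩ hzero) p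

end MeanCurvature

section Slope

open Set

variable {I : Set ℝ} {φ : ℝ → ℝ} {lam : ℝ}

theorem monotoneOn_exp_mul_deriv (hI : IsOpen I) (hconvex : Convex ℝ I) (hφ : ContDiffOn ℝ 2 φ I)
    (hineq : ∀ t ∈ I, 0 ≤ deriv (deriv φ) t + lam * deriv φ t ^ 2) :
    MonotoneOn (fun t => Real.exp (lam * φ t) * deriv φ t) I := by
  have hderiv {t : ℝ} (ht : t ∈ I) : HasDerivAt (fun t => Real.exp (lam * φ t) * deriv φ t)
      (Real.exp (lam * φ t) * (deriv (deriv φ) t + lam * deriv φ t ^ 2)) t := by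
    have hφ' : HasDerivAt φ (deriv φ t) t :=
      ((hφ.differentiableOn two_ne_zero).differentiableAt (hI.mem_nhds ht)).hasDerivAt
    have hφ'' : HasDerivAt (deriv φ) (deriv (deriv φ) t) t :=
      (((hφ.deriv_of_isOpen hI le_rfl).differentiableOn one_ne_zero).differentiableAt
        (hI.mem_nhds ht)).hasDerivAt
    exact ((hφ'.const_mul lam).exp.mul hφ'').congr_deriv (by ring)
  refine monotoneOn_of_deriv_nonneg hconvex
    (fun t ht => (hderiv ht).continuousAt.continuousWithinAt)
    (fun t ht => (hderiv (interior_subset ht)).differentiableAt.differentiableWithinAt)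
    fun t ht => ?_
  rw [(hderiv (interior_subset ht)).deriv]
  exact mul_nonneg (Real.exp_pos _).le (hineq t (interior_subset ht))

theorem deriv_pos_of_strictMonoOn (hI : IsOpen I) (hφ : ContDiffOn ℝ 2 φ I)
    (hmono : StrictMonoOn φ I) (hineq : ∀ t ∈ I, 0 ≤ deriv (deriv φ) t + lam * deriv φ t ^ 2)
    {t : ℝ} (ht : t ∈ I) : 0 < deriv φ t := by
  obtain ⟨δ, hδ, hball⟩ := Metric.isOpen_iff.1 hI t ht
  have htball := Metric.mem_ball_self (x := t) hδ
  obtain ⟨s, hst, hsub⟩ := mem_nhdsLE_iff_exists_Icc_subset.1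
    (mem_nhdsWithin_of_mem_nhds (Metric.ball_mem_nhds t hδ))
  have hdiff : DifferentiableOn ℝ φ (Icc s t) :=
    (hφ.differentiableOn two_ne_zero).mono (hsub.trans hball)
  obtain ⟨r, hr, hslope⟩ := exists_deriv_eq_slope φ hst hdiff.continuousOn
    (hdiff.mono Ioo_subset_Icc_self)
  have hrpos : 0 < deriv φ r := by
    rw [hslope]
    exact div_pos (sub_pos.2 (hmono (hball (hsub (left_mem_Icc.2 hst.le))) ht hst))
      (sub_pos.2 hst)
  have hle := monotoneOn_exp_mul_deriv Metric.isOpen_ball (convex_ball t δ) (hφ.mono hball)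
    (fun t ht => hineq t (hball ht)) (hsub (Ioo_subset_Icc_self hr)) htball hr.2.le
  exact pos_of_mul_pos_right ((mul_pos (Real.exp_pos _) hrpos).trans_le hle) (Real.exp_pos _).le

end Slope

theorem e3_ne_zero : e3 ≠ 0 := by
  simp [e3]

theorem isVerticalPlane_mk' (q : E3) {ν : E3} (hν : ν ≠ 0) (horth : inner ℝ ν e3 = 0) :
    IsVerticalPlane (AffineSubspace.mk' q (Submodule.span ℝ {ν})ᗮ) := by
  have : Fact (Module.finrank ℝ E3 = 2 + 1) := ⟨by simp⟩
  rw [IsVerticalPlane, AffineSubspace.direction_mk']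
  exact ⟨Submodule.finrank_orthogonal_span_singleton hν,
    Submodule.mem_orthogonal_singleton_iff_inner_right.2 horth⟩

theorem mainTheorem6_general {I : Set ℝ} (hI : IsOpen I) {φ : ℝ → ℝ} (hφ : ContDiffOn ℝ 2 φ I)
    (hφ_pos : ∀ t ∈ I, 0 < deriv φ t)
    {M : Type*} [TopologicalSpace M] [ChartedSpace (EuclideanSpace ℝ (Fin 2)) M]
    [IsManifold (𝓡 2) ∞ M] [PreconnectedSpace M]
    {f N : M → E3} (hf : IsPhiMinimal φ I f N)
    (hH : ∀ p, meanCurvature f N p ≤ 0)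
    (hzero : ∃ p, meanCurvature f N p = 0) :
    (∀ p, meanCurvature f N p = 0) ∧
      ∃ P : AffineSubspace ℝ E3, IsVerticalPlane P ∧ Set.range f ⊆ (P : Set E3) := by
  have hpos (p : M) := hφ_pos _ (hf.mem_slab p)
  have hmean := hf.meanCurvature_eq_neg_deriv_mul hI (hφ.differentiableOn two_ne_zero)
  simp only [hmean, neg_nonpos, mul_nonneg_iff_of_pos_left (hpos _), neg_eq_zero, mul_eq_zero,
    (hpos _).ne', false_or] at hH hzero
  have hvertical := hf.inner_e3_eq_zero hI hφ hH hzero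
  have hminimal (p : M) : meanCurvature f N p = 0 := by rw [hmean, hvertical, mul_zero, neg_zero]
  have hflat := hf.immersion.surfDiff_normal_eq_zero hf.gaussMap hminimal e3_ne_zero hvertical
  obtain ⟨p₀, -⟩ := hzero
  have hnormal : N p₀ ≠ 0 := norm_ne_zero_iff.1 (by simp [hf.gaussMap.norm_eq_one])
  refine ⟨hminimal, _, isVerticalPlane_mk' (f p₀) hnormal (hvertical p₀), ?_⟩
  rintro _ ⟨p, rfl⟩
  rw [SetLike.mem_coe, AffineSubspace.mem_mk', Submodule.mem_orthogonal_singleton_iff_inner_right,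
    vsub_eq_sub, inner_sub_right, sub_eq_zero]
  exact (hf.immersion.inner_eq_of_surfDiff_normal_eq_zero hf.gaussMap hflat p₀ p).symm

theorem mainTheorem6
    (I : Set ℝ) (hI_open : IsOpen I) (hI_conn : I.OrdConnected)
    (φ : ℝ → ℝ) (hφ_smooth : ContDiffOn ℝ ∞ φ I) (hφ_mono : StrictMonoOn φ I)
    (lam : ℝ) (hlam : 0 < lam)
    (hφ : ∀ t ∈ I, 0 ≤ deriv (deriv φ) t + lam * (deriv φ t) ^ 2)
    {M : Type*} [TopologicalSpace M] [ChartedSpace (EuclideanSpace ℝ (Fin 2)) M]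
    [IsManifold (𝓡 2) ∞ M] [ConnectedSpace M]
    (f N : M → E3) (hf : IsPhiMinimal φ I f N)
    (hH : ∀ p, meanCurvature f N p ≤ 0)
    (hzero : ∃ p, meanCurvature f N p = 0) :
    (∀ p, meanCurvature f N p = 0) ∧
      ∃ P : AffineSubspace ℝ E3, IsVerticalPlane P ∧ Set.range f ⊆ (P : Set E3) := by
  have hφ_two : ContDiffOn ℝ 2 φ I := hφ_smooth.of_le (WithTop.coe_le_coe.2 le_top)
  exact mainTheorem6_general hI_open hφ_two
    (fun _ => deriv_pos_of_strictMonoOn hI_open hφ_two hφ_mono hφ) hf hH hzero
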